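/- Let $\Sigma$ be a closed (compact, without boundary), connected, oriented smooth surface, let $\varphi:\Sigma\to\Sigma$ be a diffeomorphism, and let $M$ be its mapping torus, i.e. the quotient space of $\Sigma\times[0,1]$ obtained by identifying $(x,0)$ with $(\varphi(x),1)$ for all $x\in\Sigma$. Let $\varphi_{*1}:H_1(\Sigma;\mathbb Q)\to H_1(\Sigma;\mathbb Q)$ be the map induced on first rational singular homology and let $V_1=\{v\in H_1(\Sigma;\mathbb Q):\varphi_{*1}(v)=v\}$ be its eigenspace for the eigenvalue $1$ (so $V_1=0$ if $1$ is not an eigenvalue). Then $H_1(\Sigma;\mathbb Q)$ and $H_1(M;\mathbb Q)$ are finite-dimensional, and the first Betti number $b_1(M)=\dim_{\mathbb Q}H_1(M;\mathbb Q)$ satisfies $$b_1(M)=\dim_{\mathbb Q} V_1+1.$$ In particular, $b_1(M)=1$ if and only if $1$ is not an eigenvalue of $\varphi_{*1}$. -/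

import Mathlib

open CategoryTheory AlgebraicTopology
open scoped Manifold ContDiff

universe u

/-- The gluing relation `(x, 0) ∼ (φ x, 1)` on `X × [0, 1]`. -/
inductive MappingTorus.Glue {X : Type u} [TopologicalSpace X] (φ : X ≃ₜ X) :
    X × unitInterval → X × unitInterval → Prop
  | glue (x : X) : MappingTorus.Glue φ (x, 0) (φ x, 1)

/-- The mapping torus of a homeomorphism `φ : X → X`: the quotient of `X × [0, 1]` by the
equivalence relation generated by `(x, 0) ∼ (φ x, 1)`. -/
def MappingTorus {X : Type u} [TopologicalSpace X] (φ : X ≃ₜ X) : Type u :=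
  Quot (MappingTorus.Glue φ)

/-- The mapping torus carries the quotient topology. -/
instance MappingTorus.instTopologicalSpace {X : Type u} [TopologicalSpace X] (φ : X ≃ₜ X) :
    TopologicalSpace (MappingTorus φ) :=
  inferInstanceAs (TopologicalSpace (Quot (MappingTorus.Glue φ)))

/-- An orientation of a smooth surface, given by an oriented atlas: a family of smooth charts
that cover the surface and whose transition maps all have positive Jacobian determinant. -/
structure SurfaceOrientation (S : Type u) [TopologicalSpace S]
    [ChartedSpace (EuclideanSpace ℝ (Fin 2)) S] where
  /-- The charts of the oriented atlas. -/
  charts : Set (OpenPartialHomeomorph S (EuclideanSpace ℝ (Fin 2)))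
  smooth : charts ⊆ IsManifold.maximalAtlas (𝓡 2) ∞ S
  cover : ∀ x : S, ∃ e ∈ charts, x ∈ e.source
  det_pos : ∀ e ∈ charts, ∀ e' ∈ charts, ∀ y ∈ (e.symm.trans e').source,
    0 < (fderiv ℝ (e.symm.trans e') y).det

/-- Rational singular homology `H_n(X; ℚ)` as a `ℚ`-vector space. The coefficient module is the
copy of `ℚ` in the universe of `X`. -/
noncomputable abbrev RatHomology (n : ℕ) (X : Type u) [TopologicalSpace X] : ModuleCat.{u} ℚ :=
  ((singularHomologyFunctor (ModuleCat.{u} ℚ) n).obj (ModuleCat.of ℚ (ULift.{u} ℚ))).obj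
    (TopCat.of X)

/-- The linear map `f_* : H_n(X; ℚ) → H_n(Y; ℚ)` induced by a continuous map `f`. -/
noncomputable def ratHomologyMap (n : ℕ) {X Y : Type u} [TopologicalSpace X] [TopologicalSpace Y]
    (f : C(X, Y)) : RatHomology n X →ₗ[ℚ] RatHomology n Y :=
  (((singularHomologyFunctor (ModuleCat.{u} ℚ) n).obj (ModuleCat.of ℚ (ULift.{u} ℚ))).map
    (TopCat.ofHom f)).hom

/-- The `n`-th Betti number `dim H_n(X; ℚ)`. -/
noncomputable def bettiNumber (n : ℕ) (X : Type u) [TopologicalSpace X] : ℕ :=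
  Module.finrank ℚ (RatHomology n X)

/-!
The two halves of the statement, the computation of `H₁` of the mapping torus `M` of `φ : S → S`
and the finiteness of `H₁(S; ℚ)`, have independent proofs.

The map `S × ℝ → M`, `(x, t) ↦ [φ⁻ⁿ x, t - n]` for `n ≤ t ≤ n + 1`, is a covering map whose deck
group is generated by `τ (x, t) = (φ x, t + 1)` (`MappingTorus.isCoveringMap_coverFun`). A standard
simplex is simply connected, so every singular simplex of `M` lifts, uniquely up to powers of `τ`.
In each degree the chains of `S × ℝ` are thus a free `ℚ[τ, τ⁻¹]`-module with coinvariants the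
chains of `M`, and `0 → C(S × ℝ) → C(S × ℝ) → C(M) → 0`, with first map `τ - 1`, is exact
(`IsCoveringMap.orbitShortComplex_shortExact`). In the long exact sequence,
`H₁(S × ℝ)` is `H₁(S)` with `τ` acting as `φ`, while `H₀(S × ℝ)` is one-dimensional with trivial
action of `τ`. So `H₁(M)` is an extension of a line by the cokernel of `φ_* - 1`, whose dimension
is that of the kernel once `H₁(S)` is finite-dimensional (`MappingTorus.finrank_ratHomology_one`).

For the finiteness, work with `1`-chains modulo boundaries, in which `H₁` is the kernel of the
boundary map `∂` to `0`-chains. On a set `U` which is contractible in `S` the class of a path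
depends only on its end points: it is the increment of a potential `Q` on `U`
(`exists_isPotential_of_nullhomotopic`). Take a finite cover by path connected open sets `V i` with
potentials `Q i`, so small that the union of two members that meet is contractible in `S`; then
`Q i - Q j` is constant on `V i ∩ V j`. Choose an index `i x` with `x ∈ V (i x)` for each
point and let `h` be the linear map with `h [x] = Q (i x) x`. The operator `1 - h ∂` fixes `H₁`, and
it sends a path in a single `V k` to a difference of two of the finitely many constants
`Q k - Q j`. As every path subdivides into such small ones, `H₁` lies in the span of these
constants (`finite_ratHomology_one_of_isPotential`).
-/

/-! ### Chains on a free quotient by an infinite cyclic group -/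

section FreeIntAction

variable {k M X Y : Type*} [Ring k] [AddCommGroup M] [Module k M]

/-- For a free action of `ℤ` on a set, no nonzero finitely supported function is invariant. -/
lemma Finsupp.mapDomain_sub_id_injective (σ : Equiv.Perm X)
    (hfree : ∀ (n : ℤ) (x : X), (σ ^ n) x = x → n = 0) :
    Function.Injective (Finsupp.lmapDomain M k σ - LinearMap.id : (X →₀ M) →ₗ[k] X →₀ M) := by
  rw [← LinearMap.ker_eq_bot, LinearMap.ker_eq_bot']
  intro c hc
  have hc : Finsupp.mapDomain σ c = c := sub_eq_zero.1 hc
  have h1 (x : X) : c (σ x) = c x := by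
    conv_lhs => rw [← hc]
    exact Finsupp.mapDomain_apply σ.injective c x
  have h2 (n : ℕ) (x : X) : c ((σ ^ n) x) = c x := by
    induction n with
    | zero => rfl
    | succ n ih => rw [pow_succ', Equiv.Perm.mul_apply, h1, ih]
  ext x
  by_contra hx
  -- the infinite orbit of a point of the support lies in the support
  refine Set.infinite_of_injective_forall_mem (f := fun n : ℕ => (σ ^ n) x) ?_
    (s := (c.support : Set X)) (fun n => ?_) c.support.finite_toSet
  · intro m n hmn
    have : (σ ^ ((m : ℤ) - n)) ((σ ^ n) x) = (σ ^ n) x := by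
      rw [← Equiv.Perm.mul_apply, ← zpow_natCast σ n, ← zpow_add, sub_add_cancel, zpow_natCast,
        zpow_natCast]
      exact hmn
    have := hfree _ _ this
    omega
  · simpa [h2] using hx

/-- Chains on an orbit space: a chain on `X` which vanishes on the orbit space of `σ` lies in the
image of `σ - 1`. -/
lemma Finsupp.exact_mapDomain_sub_id (σ : Equiv.Perm X) (p : X → Y)
    (hp : Function.Surjective p) (hσ : ∀ x y, p x = p y ↔ ∃ n : ℤ, (σ ^ n) x = y) :
    Function.Exact (Finsupp.lmapDomain M k σ - LinearMap.id : (X →₀ M) →ₗ[k] X →₀ M)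
      (Finsupp.lmapDomain M k p) := by
  set d : (X →₀ M) →ₗ[k] X →₀ M := Finsupp.lmapDomain M k σ - LinearMap.id
  have hpσ (x : X) : p (σ x) = p x := ((hσ _ _).2 ⟨1, by simp⟩).symm
  rw [LinearMap.exact_iff]
  refine le_antisymm (fun c hc => ?_) ?_
  · let q := (LinearMap.range d).mkQ
    have hstep (x : X) (m : M) : q (single (σ x) m) = q (single x m) := by
      rw [← sub_eq_zero, ← map_sub]
      exact (Submodule.Quotient.mk_eq_zero _).2 ⟨single x m, by simp [d]⟩
    have hnat (n : ℕ) (x : X) (m : M) : q (single ((σ ^ n) x) m) = q (single x m) := by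
      induction n with
      | zero => rfl
      | succ n ih => rw [pow_succ', Equiv.Perm.mul_apply, hstep, ih]
    have hint (n : ℤ) (x : X) (m : M) : q (single ((σ ^ n) x) m) = q (single x m) := by
      obtain ⟨n, rfl | rfl⟩ := n.eq_nat_or_neg
      · exact hnat n x m
      · rw [← hnat n]
        simp
    -- a set-theoretic section of `p` induces a factorization of `q` through `p`
    have hfac : q ∘ₗ Finsupp.lmapDomain M k (Function.surjInv hp) ∘ₗ Finsupp.lmapDomain M k p
        = q := by
      ext x m
      obtain ⟨n, hn⟩ := (hσ _ x).1 (Function.surjInv_eq hp (p x))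
      simp only [LinearMap.comp_apply, Finsupp.lsingle_apply, Finsupp.lmapDomain_apply,
        Finsupp.mapDomain_single]
      rw [← hint n, hn]
    have : q c = 0 := by
      rw [← hfac]
      simp only [LinearMap.comp_apply]
      rw [LinearMap.mem_ker.1 hc, map_zero, map_zero]
    exact (Submodule.Quotient.mk_eq_zero _).1 this
  · rw [LinearMap.range_le_ker_iff]
    ext x m : 2
    simp [d, -Finsupp.lmapDomain_apply, map_sub]
    simp [hpσ]

end FreeIntAction

section SimplicialChains

variable {k : Type*} [CommRing k]

open Simplicial

/-- Simplicial `n`-chains as finitely supported functions on the set of `n`-simplices. -/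
noncomputable def SSet.finsuppEquivChain (X : SSet.{u}) (R : ModuleCat.{u} k) (n : ℕ) :
    (X _⦋n⦌ →₀ R) ≃ₗ[k] (X.chainComplex R).X n := by
  classical
  exact (finsuppLEquivDirectSum k R (X _⦋n⦌)).trans
    (ModuleCat.coprodIsoDirectSum (fun _ : X _⦋n⦌ => R)).symm.toLinearEquiv

variable {X Y : SSet.{u}} {R : ModuleCat.{u} k} {n : ℕ}

@[simp]
lemma SSet.finsuppEquivChain_single (x : X _⦋n⦌) (r : R) :
    X.finsuppEquivChain R n (Finsupp.single x r) = X.ιChainComplex (R := R) x r := by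
  classical
  have := ModuleCat.lof_coprodIsoDirectSum_inv (fun _ : X _⦋n⦌ => R) x
  rw [SSet.ιChainComplex, ← this]
  change (ModuleCat.coprodIsoDirectSum (fun _ : X _⦋n⦌ => R)).inv
    (finsuppLEquivDirectSum k R (X _⦋n⦌) (Finsupp.single x r)) = _
  rw [finsuppLEquivDirectSum_single]
  rfl

lemma SSet.chainComplexMap_f_finsuppEquivChain (f : X ⟶ Y) (c : X _⦋n⦌ →₀ R) :
    (SSet.chainComplexMap f R).f n (X.finsuppEquivChain R n c) =
      Y.finsuppEquivChain R n (Finsupp.lmapDomain R k (f.app _) c) := by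
  induction c using Finsupp.induction_linear with
  | zero => simp
  | add a b ha hb => simp only [map_add, ha, hb]
  | single x r =>
    rw [Finsupp.lmapDomain_apply, Finsupp.mapDomain_single, SSet.finsuppEquivChain_single,
      SSet.finsuppEquivChain_single, ← SSet.ι_chainComplexMap_f]
    rfl

/-- The short complex of chain complexes `C(X) → C(X) → C(Y)` given by `σ - 1` and `p`. -/
noncomputable def SSet.orbitShortComplex (σ : X ⟶ X) (p : X ⟶ Y) (hσp : σ ≫ p = p)
    (R : ModuleCat.{u} k) : ShortComplex (ChainComplex (ModuleCat.{u} k) ℕ) where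
  X₁ := X.chainComplex R
  X₂ := X.chainComplex R
  X₃ := Y.chainComplex R
  f := SSet.chainComplexMap σ R - 𝟙 _
  g := SSet.chainComplexMap p R
  zero := by
    rw [Preadditive.sub_comp, Category.id_comp, ← Functor.map_comp, hσp, sub_self]

/-- If in each degree `σ` generates a free action of `ℤ` on the simplices of `X`, with orbit
space the simplices of `Y`, then `0 → C(X) → C(X) → C(Y) → 0` is exact. -/
lemma SSet.orbitShortComplex_shortExact (σ : X ⟶ X) (p : X ⟶ Y) (hσp : σ ≫ p = p)
    (R : ModuleCat.{u} k) (e : ∀ n : ℕ, Equiv.Perm (X _⦋n⦌))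
    (he : ∀ (n : ℕ) (x : X _⦋n⦌), e n x = σ.app _ x)
    (hfree : ∀ (n : ℕ) (m : ℤ) (x : X _⦋n⦌), (e n ^ m) x = x → m = 0)
    (hp : ∀ n : ℕ, Function.Surjective (p.app (.op ⦋n⦌)))
    (horbit : ∀ (n : ℕ) (x y : X _⦋n⦌), p.app _ x = p.app _ y ↔ ∃ m : ℤ, (e n ^ m) x = y) :
    (SSet.orbitShortComplex σ p hσp R).ShortExact := by
  refine HomologicalComplex.shortExact_of_degreewise_shortExact _ fun n => ?_
  have hf (c : X _⦋n⦌ →₀ R) : (SSet.chainComplexMap σ R - 𝟙 _).f n (X.finsuppEquivChain R n c) =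
      X.finsuppEquivChain R n
        ((Finsupp.lmapDomain R k (e n) - LinearMap.id : (X _⦋n⦌ →₀ R) →ₗ[k] _) c) := by
    have : (e n : X _⦋n⦌ → X _⦋n⦌) = σ.app _ := funext (he n)
    rw [LinearMap.sub_apply, map_sub, this, ← SSet.chainComplexMap_f_finsuppEquivChain]
    rfl
  refine ShortComplex.ShortExact.mk' ?_ ?_ ?_
  · rw [ShortComplex.moduleCat_exact_iff]
    intro c hc
    obtain ⟨c, rfl⟩ := (X.finsuppEquivChain R n).surjective c
    have hc : (SSet.chainComplexMap p R).f n (X.finsuppEquivChain R n c) = 0 := hc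
    rw [SSet.chainComplexMap_f_finsuppEquivChain, LinearEquiv.map_eq_zero_iff] at hc
    obtain ⟨b, rfl⟩ := (Finsupp.exact_mapDomain_sub_id (k := k) (e n) _ (hp n) (horbit n) c).1 hc
    exact ⟨_, hf b⟩
  · rw [ModuleCat.mono_iff_injective]
    refine (injective_iff_map_eq_zero _).2 fun c hc => ?_
    obtain ⟨c, rfl⟩ := (X.finsuppEquivChain R n).surjective c
    have hc := (X.finsuppEquivChain R n).map_eq_zero_iff.1 ((hf c).symm.trans hc)
    rw [(injective_iff_map_eq_zero _).1 (Finsupp.mapDomain_sub_id_injective (e n) (hfree n)) c hc,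
      map_zero]
    rfl
  · rw [ModuleCat.epi_iff_surjective]
    intro c
    obtain ⟨c, rfl⟩ := (Y.finsuppEquivChain R n).surjective c
    obtain ⟨b, rfl⟩ := Finsupp.mapDomain_surjective (hp n) c
    exact ⟨_, SSet.chainComplexMap_f_finsuppEquivChain p b⟩

end SimplicialChains

/-! ### Infinite cyclic covers and the mapping torus -/

section CyclicCover

open Simplicial

variable {E M : Type u} [TopologicalSpace E] [TopologicalSpace M]

instance stdSimplex.simplyConnectedSpace (n : ℕ) :
    SimplyConnectedSpace (stdSimplex ℝ (Fin (n + 1))) :=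
  have : ContractibleSpace (stdSimplex ℝ (Fin (n + 1))) :=
    (convex_stdSimplex ℝ _).contractibleSpace ⟨_, single_mem_stdSimplex ℝ 0⟩
  inferInstance

instance stdSimplex.locallyPathConnectedSpace (n : ℕ) :
    LocallyPathConnectedSpace (stdSimplex ℝ (Fin (n + 1))) :=
  (convex_stdSimplex ℝ _).locallyPathConnectedSpace

/-- A homeomorphism of `E` permutes the singular `n`-simplices of `E`. -/
noncomputable def Homeomorph.permSimplices (n : ℕ) :
    (E ≃ₜ E) →* Equiv.Perm ((TopCat.toSSet.obj (TopCat.of E)) _⦋n⦌) :=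
  (Equiv.permCongrHom (TopCat.toSSetObjEquiv (TopCat.of E) (.op ⦋n⦌)).symm).toMonoidHom.comp
    { toFun h :=
        { toFun s := (h : C(E, E)).comp s
          invFun s := (h.symm : C(E, E)).comp s
          left_inv s := by ext; simp
          right_inv s := by ext; simp }
      map_one' := by ext; rfl
      map_mul' _ _ := by ext; rfl }

lemma TopCat.toSSetObjEquiv_map (f : C(E, M)) (n : ℕ)
    (s : (TopCat.toSSet.obj (TopCat.of E)) _⦋n⦌) :
    TopCat.toSSetObjEquiv (TopCat.of M) (.op ⦋n⦌) ((TopCat.toSSet.map (TopCat.ofHom f)).app _ s) =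
      f.comp (TopCat.toSSetObjEquiv (TopCat.of E) (.op ⦋n⦌) s) := rfl

lemma Homeomorph.toSSetObjEquiv_permSimplices (h : E ≃ₜ E) (n : ℕ)
    (s : (TopCat.toSSet.obj (TopCat.of E)) _⦋n⦌) :
    TopCat.toSSetObjEquiv (TopCat.of E) (.op ⦋n⦌) (h.permSimplices n s) =
      (h : C(E, E)).comp (TopCat.toSSetObjEquiv (TopCat.of E) (.op ⦋n⦌) s) := rfl

/-- The singular chain complexes of an infinite cyclic cover: since simplices lift uniquely up to
deck transformations, `0 → C(E) → C(E) → C(M) → 0`, with first map `τ - 1`, is exact. -/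
lemma IsCoveringMap.orbitShortComplex_shortExact {k : Type*} [CommRing k] (R : ModuleCat.{u} k)
    (τ : E ≃ₜ E) (p : C(E, M)) (hp : IsCoveringMap p) (hsurj : Function.Surjective p)
    (hfree : ∀ (m : ℤ) (x : E), (τ ^ m) x = x → m = 0)
    (horbit : ∀ x y : E, p x = p y ↔ ∃ m : ℤ, (τ ^ m) x = y)
    (hτp : TopCat.toSSet.map (TopCat.ofHom (τ : C(E, E))) ≫ TopCat.toSSet.map (TopCat.ofHom p) =
      TopCat.toSSet.map (TopCat.ofHom p)) :
    (SSet.orbitShortComplex _ _ hτp R).ShortExact := by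
  refine SSet.orbitShortComplex_shortExact _ _ hτp R (fun n => τ.permSimplices n)
    (fun n s => rfl) (fun n m s h => ?_) (fun n t => ?_) (fun n s s' => ?_)
  · rw [← map_zpow] at h
    have := congr(TopCat.toSSetObjEquiv (TopCat.of E) (.op ⦋n⦌) $h)
    rw [Homeomorph.toSSetObjEquiv_permSimplices] at this
    exact hfree m _ (DFunLike.congr_fun this ⟨_, single_mem_stdSimplex ℝ 0⟩)
  · let a : stdSimplex ℝ (Fin (n + 1)) := ⟨_, single_mem_stdSimplex ℝ 0⟩
    let f : C(stdSimplex ℝ (Fin (n + 1)), M) := TopCat.toSSetObjEquiv (TopCat.of M) (.op ⦋n⦌) t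
    obtain ⟨e, he⟩ := hsurj (f a)
    obtain ⟨F, hF, -⟩ := hp.existsUnique_continuousMap_lifts f a e he
    refine ⟨(TopCat.toSSetObjEquiv (TopCat.of E) (.op ⦋n⦌)).symm F, ?_⟩
    apply (TopCat.toSSetObjEquiv (TopCat.of M) (.op ⦋n⦌)).injective
    rw [TopCat.toSSetObjEquiv_map, Equiv.apply_symm_apply]
    ext x
    exact congr_fun hF.2 x
  · let a : stdSimplex ℝ (Fin (n + 1)) := ⟨_, single_mem_stdSimplex ℝ 0⟩
    rw [← (TopCat.toSSetObjEquiv (TopCat.of M) (.op ⦋n⦌)).injective.eq_iff]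
    simp only [← (TopCat.toSSetObjEquiv (TopCat.of E) (.op ⦋n⦌)).injective.eq_iff, ← map_zpow]
    set f : C(stdSimplex ℝ (Fin (n + 1)), E) := TopCat.toSSetObjEquiv (TopCat.of E) (.op ⦋n⦌) s
    set g : C(stdSimplex ℝ (Fin (n + 1)), E) := TopCat.toSSetObjEquiv (TopCat.of E) (.op ⦋n⦌) s'
    constructor
    · intro h
      obtain ⟨m, hm⟩ := (horbit _ _).1 (DFunLike.congr_fun h a)
      refine ⟨m, ?_⟩
      -- both sides lift `p ∘ g` and agree at the vertex `a`
      have := hp.eq_of_comp_eq (g₁ := (τ ^ m) ∘ f) (g₂ := g) (by fun_prop) (by fun_prop) ?_ a hm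
      · ext x; exact congr_fun this x
      · ext x
        exact ((horbit _ _).2 ⟨m, rfl⟩).symm.trans (DFunLike.congr_fun h x)
    · rintro ⟨m, hm⟩
      ext x
      exact (horbit _ _).2 ⟨m, DFunLike.congr_fun hm x⟩

end CyclicCover

namespace MappingTorus

variable {X : Type u} [TopologicalSpace X] (φ : X ≃ₜ X)

/-- The deck transformation `(x, t) ↦ (φ x, t + 1)` of the infinite cyclic cover `X × ℝ`. -/
def deck : X × ℝ ≃ₜ X × ℝ := φ.prodCongr (Homeomorph.addRight 1)

lemma deck_zpow_apply (n : ℤ) (y : X × ℝ) : (deck φ ^ n) y = ((φ ^ n) y.1, y.2 + n) := by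
  have h1 (y : X × ℝ) : deck φ y = (φ y.1, y.2 + 1) := rfl
  have h2 (y : X × ℝ) : (deck φ)⁻¹ y = (φ⁻¹ y.1, y.2 + -1) := rfl
  induction n generalizing y with
  | zero => simp
  | succ n ih =>
    rw [zpow_add_one, zpow_add_one, Homeomorph.mul_apply, ih, h1]
    ext <;> simp [add_comm, add_left_comm]
  | pred n ih =>
    rw [zpow_sub_one, zpow_sub_one, Homeomorph.mul_apply, ih, h2]
    ext
    · rfl
    · push_cast
      ring

/-- The covering map `X × ℝ → MappingTorus φ`, which on `X × [n, n + 1]` is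
`(x, t) ↦ [φ⁻ⁿ x, t - n]`. It is encoded by taking `n = ⌊t⌋`; the other end point `t = n + 1` is
covered by `coverFun_eq`. -/
noncomputable def coverFun (y : X × ℝ) : MappingTorus φ :=
  Quot.mk _ ((φ ^ (-⌊y.2⌋)) y.1, ⟨Int.fract y.2, Int.fract_nonneg _, (Int.fract_lt_one _).le⟩)

lemma coverFun_eq (n : ℤ) (x : X) (t : ℝ) (h0 : (n : ℝ) ≤ t) (h1 : t ≤ n + 1) :
    coverFun φ (x, t) = Quot.mk _ ((φ ^ (-n)) x, Set.projIcc 0 1 zero_le_one (t - n)) := by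
  rw [Set.projIcc_of_mem zero_le_one (x := t - n) ⟨by linarith, by linarith⟩]
  rcases h1.lt_or_eq with h1 | rfl
  · obtain rfl : ⌊t⌋ = n := Int.floor_eq_iff.2 ⟨h0, h1⟩
    rfl
  · -- the endpoint `t = n + 1`, where the gluing relation is used
    have hf : ⌊(n : ℝ) + 1⌋ = n + 1 := by exact_mod_cast Int.floor_intCast (n + 1)
    have h := Quot.sound (Glue.glue (φ := φ) ((φ ^ (-(n + 1))) x))
    rw [← Homeomorph.mul_apply, ← zpow_one_add] at h
    have h1 : (⟨Int.fract ((n : ℝ) + 1), Int.fract_nonneg _, (Int.fract_lt_one _).le⟩ :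
        unitInterval) = 0 := by
      ext
      simp
    have h2 : (⟨(n : ℝ) + 1 - n, by simp, by simp⟩ : unitInterval) = 1 := by
      ext
      simp
    unfold coverFun
    rw [h1, h2, hf, h]
    congr 4
    ring

lemma continuous_coverFun : Continuous (coverFun φ) := by
  have hfin : LocallyFinite fun n : ℤ => (Prod.snd : X × ℝ → ℝ) ⁻¹' Set.Icc (n : ℝ) (n + 1) := by
    refine LocallyFinite.preimage_continuous ?_ continuous_snd
    refine locallyFinite_Icc_of_tendsto tendsto_intCast_atTop_atTop ?_
    exact Filter.tendsto_atBot_add_const_right _ _ (tendsto_intCast_atBot_iff.2 Filter.tendsto_id)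
  refine hfin.continuous ?_ (fun n => isClosed_Icc.preimage continuous_snd) fun n => ?_
  · refine Set.eq_univ_of_forall fun y => Set.mem_iUnion.2 ⟨⌊y.2⌋, Int.floor_le _, ?_⟩
    exact (Int.lt_floor_add_one _).le
  · refine ContinuousOn.congr (f := fun y : X × ℝ => (Quot.mk _ ((φ ^ (-n)) y.1,
      Set.projIcc 0 1 zero_le_one (y.2 - n)) : MappingTorus φ)) ?_
      fun y hy => coverFun_eq φ n y.1 y.2 hy.1 hy.2
    refine Continuous.continuousOn (continuous_quot_mk.comp ?_)
    exact ((φ ^ (-n)).continuous.comp continuous_fst).prodMk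
      (continuous_projIcc.comp (by fun_prop))

lemma coverFun_inclusion (x : X) (s : unitInterval) :
    coverFun φ (x, (s : ℝ)) = Quot.mk _ (x, s) := by
  rw [coverFun_eq φ 0 x s (by simpa using s.2.1) (by simpa using s.2.2)]
  simp [Set.projIcc_val]
  rfl

/-- The restriction of the covering map to `X × [0, 1]` is already a quotient map, by definition of
the mapping torus. -/
lemma isQuotientMap_coverFun : Topology.IsQuotientMap (coverFun φ) := by
  refine Topology.IsQuotientMap.of_comp (f := fun y : X × unitInterval => (y.1, (y.2 : ℝ)))
    (by fun_prop) (continuous_coverFun φ) ?_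
  rw [show coverFun φ ∘ (fun y : X × unitInterval => (y.1, (y.2 : ℝ))) = Quot.mk (Glue φ) from
    funext fun y => coverFun_inclusion φ y.1 y.2]
  exact isQuotientMap_quot_mk

lemma coverFun_eq_coverFun_iff (y z : X × ℝ) :
    coverFun φ y = coverFun φ z ↔ ∃ n : ℤ, (deck φ ^ n) y = z := by
  constructor
  · intro h
    let r : X × ℝ → X × ℝ → Prop := fun y z => ∃ n : ℤ, (deck φ ^ n) y = z
    have hr : _root_.Equivalence r := by
      refine ⟨fun y => ⟨0, rfl⟩, ?_, ?_⟩
      · rintro y _ ⟨n, rfl⟩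
        exact ⟨-n, by rw [← Homeomorph.mul_apply, ← zpow_add, neg_add_cancel, zpow_zero,
          Homeomorph.one_apply]⟩
      · rintro y _ _ ⟨n, rfl⟩ ⟨m, rfl⟩
        exact ⟨m + n, by rw [zpow_add, Homeomorph.mul_apply]⟩
    -- the inclusion of `X × [0, 1]` descends to a map from the mapping torus to the orbit space
    let q : MappingTorus φ → Quot r := Quot.lift (fun y => Quot.mk r (y.1, (y.2 : ℝ))) (by
      rintro _ _ ⟨x⟩
      refine Quot.sound ⟨1, ?_⟩
      rw [deck_zpow_apply]
      simp)
    have hq (y : X × ℝ) : q (coverFun φ y) = Quot.mk r y := by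
      refine Quot.sound ⟨⌊y.2⌋, ?_⟩
      rw [deck_zpow_apply]
      ext
      · rw [← Homeomorph.mul_apply, ← zpow_add]
        simp
      · simp [Int.fract_add_floor]
    have h := congr(q $h)
    rw [hq, hq] at h
    exact (hr.quot_mk_eq_iff _ _).1 h
  · rintro ⟨n, rfl⟩
    rw [deck_zpow_apply]
    unfold coverFun
    simp only [Int.floor_add_intCast, Int.fract_add_intCast, ← Homeomorph.mul_apply, ← zpow_add]
    rw [neg_add_rev, neg_add_cancel_comm]

lemma deck_zpow_apply_eq_self (n : ℤ) (y : X × ℝ) (h : (deck φ ^ n) y = y) : n = 0 := by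
  rw [deck_zpow_apply] at h
  simpa using congr(($h).2)

lemma isCoveringMap_coverFun : IsCoveringMap (coverFun φ) := by
  have hpow (n : ℤ) (y : X × ℝ) : ((deck φ).toEquiv ^ n) y = (deck φ ^ n) y := by
    let toPerm : (X × ℝ ≃ₜ X × ℝ) →* Equiv.Perm (X × ℝ) :=
      { toFun h := h.toEquiv
        map_one' := rfl
        map_mul' _ _ := rfl }
    exact congr($((map_zpow toPerm (deck φ) n).symm) y)
  let G : Subgroup (Equiv.Perm (X × ℝ)) := Subgroup.zpowers (deck φ).toEquiv
  have hG (g : G) : ∃ n : ℤ, ∀ y, g • y = (deck φ ^ n) y := by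
    obtain ⟨_, n, rfl⟩ := g
    refine ⟨n, fun y => ?_⟩
    change ((deck φ).toEquiv ^ n) y = _
    rw [hpow]
  have : ContinuousConstSMul G (X × ℝ) := ⟨fun g => by
    obtain ⟨n, hn⟩ := hG g
    simpa only [hn] using (deck φ ^ n).continuous⟩
  suffices h : IsQuotientCoveringMap (coverFun φ) G from h.isCoveringMap
  refine ⟨isQuotientMap_coverFun φ, this, fun {y z} => ?_, fun y => ?_⟩
  · rw [eq_comm, coverFun_eq_coverFun_iff]
    constructor
    · rintro ⟨n, rfl⟩
      exact ⟨⟨_, n, rfl⟩, by rw [← hpow]; rfl⟩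
    · rintro ⟨g, rfl⟩
      obtain ⟨n, hn⟩ := hG g
      exact ⟨n, (hn z).symm⟩
  · refine ⟨Prod.snd ⁻¹' Set.Ioo (y.2 - 1 / 2) (y.2 + 1 / 2), (isOpen_Ioo.preimage
      continuous_snd).mem_nhds ⟨by linarith, by linarith⟩, fun g => ?_⟩
    rintro ⟨_, ⟨z, hz, rfl⟩, hgz⟩
    obtain ⟨n, hn⟩ := hG g
    obtain ⟨hz1, hz2⟩ := hz
    obtain ⟨h1, h2⟩ := hgz
    simp only [hn, deck_zpow_apply] at h1 h2
    have hlt : (n : ℝ) < 1 := by linarith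
    have hgt : (-1 : ℝ) < n := by linarith
    obtain rfl : n = 0 := by
      have : n < 1 := by exact_mod_cast hlt
      have : -1 < n := by exact_mod_cast hgt
      omega
    ext1
    ext1 w
    exact hn w

end MappingTorus

/-! ### The Wang sequence in low degrees -/

section Augmentation

variable {k : Type*} [CommRing k] {X Y : SSet.{u}} (R : ModuleCat.{u} k)

open Simplicial

/-- Naturality of the augmentation. -/
lemma SSet.homologyMap_homology₀ε (f : X ⟶ Y) :
    SSet.homologyMap f R 0 ≫ Y.homology₀ε R = X.homology₀ε R := by
  have : IsIso ((X.chainComplex R).iCycles 0) :=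
    (X.chainComplex R).isIso_iCycles 0 _ rfl (by simp)
  rw [← cancel_epi ((X.chainComplex R).homologyπ 0),
    ← cancel_epi (inv ((X.chainComplex R).iCycles 0))]
  refine SSet.chainComplex_hom_ext fun x => ?_
  have hx : X.ιChainComplex x ≫ inv ((X.chainComplex R).iCycles 0) =
      (X.chainComplex R).liftCycles (X.ιChainComplex x) 0 (by simp) (by simp) := by
    rw [IsIso.comp_inv_eq, HomologicalComplex.liftCycles_i]
  rw [reassoc_of% hx, reassoc_of% hx, SSet.liftCycles_ιChainComplex_homologyπ_homology₀ε,
    HomologicalComplex.homologyπ_naturality_assoc,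
    HomologicalComplex.liftCycles_comp_cyclesMap_assoc]
  simp only [SSet.ι_chainComplexMap_f]
  exact SSet.liftCycles_ιChainComplex_homologyπ_homology₀ε Y R (f.app _ x)

end Augmentation

section HomotopyInvariance

variable {X Y Z : Type u} [TopologicalSpace X] [TopologicalSpace Y] [TopologicalSpace Z]

lemma ratHomologyMap_comp (n : ℕ) (g : C(Y, Z)) (f : C(X, Y)) :
    ratHomologyMap n (g.comp f) = ratHomologyMap n g ∘ₗ ratHomologyMap n f := by
  unfold ratHomologyMap
  rw [TopCat.ofHom_comp, Functor.map_comp, ModuleCat.hom_comp]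

lemma ratHomologyMap_id (n : ℕ) :
    ratHomologyMap n (ContinuousMap.id X) = LinearMap.id := by
  unfold ratHomologyMap
  rw [TopCat.ofHom_id, CategoryTheory.Functor.map_id, ModuleCat.hom_id]

lemma ContinuousMap.Homotopic.ratHomologyMap_eq (n : ℕ) {f g : C(X, Y)} (h : f.Homotopic g) :
    ratHomologyMap n f = ratHomologyMap n g := by
  obtain ⟨H⟩ := h
  exact congr(ModuleCat.Hom.hom $(TopCat.Homotopy.congr_homologyMap_singularChainComplexFunctor
    (f := TopCat.ofHom f) (g := TopCat.ofHom g) H (ModuleCat.of ℚ (ULift.{u} ℚ)) n))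

/-- A homotopy equivalence induces isomorphisms on rational homology. -/
noncomputable def ContinuousMap.HomotopyEquiv.ratHomologyEquiv (n : ℕ)
    (e : ContinuousMap.HomotopyEquiv X Y) : RatHomology n X ≃ₗ[ℚ] RatHomology n Y :=
  LinearEquiv.ofLinearMap (ratHomologyMap n e.toFun) (ratHomologyMap n e.invFun)
    (by rw [← ratHomologyMap_comp, e.right_inv.ratHomologyMap_eq, ratHomologyMap_id])
    (by rw [← ratHomologyMap_comp, e.left_inv.ratHomologyMap_eq, ratHomologyMap_id])

end HomotopyInvariance

/-- Dimension count in an exact sequence `A → A → B → C → 0` with `C` a line. The cokernel and the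
kernel of the endomorphism `f` have the same dimension. -/
lemma LinearMap.finrank_of_exact_of_finrank_eq_one {k A B C : Type*} [Field k] [AddCommGroup A]
    [Module k A] [AddCommGroup B] [Module k B] [AddCommGroup C] [Module k C] [Module.Finite k A]
    (f : A →ₗ[k] A) (g : A →ₗ[k] B) (d : B →ₗ[k] C) (hfg : LinearMap.range f = LinearMap.ker g)
    (hgd : LinearMap.range g = LinearMap.ker d) (hd : Function.Surjective d)
    (hC : Module.finrank k C = 1) :
    Module.Finite k B ∧ Module.finrank k B = Module.finrank k (LinearMap.ker f) + 1 := by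
  have : Module.Finite k C := Module.finite_of_finrank_eq_succ hC
  have hfin : Module.Finite k (LinearMap.ker d) := hgd ▸ inferInstance
  have hB : Module.Finite k B := by
    have : Module.Finite k (B ⧸ LinearMap.ker d) :=
      Module.Finite.equiv (d.quotKerEquivOfSurjective hd).symm
    exact Module.Finite.of_submodule_quotient (LinearMap.ker d)
  refine ⟨hB, ?_⟩
  have h1 := f.finrank_range_add_finrank_ker
  have h2 := g.finrank_range_add_finrank_ker
  have h3 := d.finrank_range_add_finrank_ker
  rw [LinearMap.range_eq_top.2 hd, finrank_top, hC, ← hgd] at h3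
  rw [← hfg] at h2
  omega

namespace MappingTorus

variable {X : Type u} [TopologicalSpace X] (φ : X ≃ₜ X)

/-- The covering map `coverFun` as a continuous map. -/
noncomputable def cover : C(X × ℝ, MappingTorus φ) := ⟨coverFun φ, continuous_coverFun φ⟩

lemma cover_comp_deck : (cover φ).comp (deck φ : C(X × ℝ, X × ℝ)) = cover φ := by
  ext y
  exact ((coverFun_eq_coverFun_iff φ _ _).2 ⟨1, by simp⟩).symm

/-- The projection `X × ℝ → X` is a homotopy equivalence. -/
noncomputable def coverHomotopyEquiv (X : Type u) [TopologicalSpace X] :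
    ContinuousMap.HomotopyEquiv (X × ℝ) X where
  toFun := ⟨Prod.fst, continuous_fst⟩
  invFun := ⟨fun x => (x, 0), by fun_prop⟩
  left_inv := ⟨{
    toFun z := (z.2.1, (z.1 : ℝ) * z.2.2)
    continuous_toFun := by fun_prop
    map_zero_left y := by ext <;> simp
    map_one_left y := by ext <;> simp }⟩
  right_inv := ContinuousMap.Homotopic.refl _

/-- The tail `H₁(X) → H₁(X) → H₁(M) → H₀(X) → 0` of the Wang sequence of a mapping torus, in
terms of dimensions. -/
theorem finrank_ratHomology_one [PathConnectedSpace X] [Module.Finite ℚ (RatHomology 1 X)] :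
    Module.Finite ℚ (RatHomology 1 (MappingTorus φ)) ∧
      Module.finrank ℚ (RatHomology 1 (MappingTorus φ)) =
        Module.finrank ℚ (Module.End.eigenspace (ratHomologyMap 1 (φ : C(X, X))) (1 : ℚ)) + 1 := by
  set R : ModuleCat.{u} ℚ := ModuleCat.of ℚ (ULift.{u} ℚ)
  set τ : C(X × ℝ, X × ℝ) := (deck φ : C(X × ℝ, X × ℝ))
  have hτp : TopCat.toSSet.map (TopCat.ofHom τ) ≫ TopCat.toSSet.map (TopCat.ofHom (cover φ)) =
      TopCat.toSSet.map (TopCat.ofHom (cover φ)) := by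
    rw [← Functor.map_comp, ← TopCat.ofHom_comp, cover_comp_deck]
  have hS := (isCoveringMap_coverFun φ).orbitShortComplex_shortExact (p := cover φ) R (deck φ)
    (isQuotientMap_coverFun φ).surjective (deck_zpow_apply_eq_self φ)
    (coverFun_eq_coverFun_iff φ) hτp
  have hmap (n : ℕ) : (HomologicalComplex.homologyMap
      (SSet.orbitShortComplex _ _ hτp R).f n).hom = ratHomologyMap n τ - LinearMap.id := by
    have h : HomologicalComplex.homologyMap (SSet.chainComplexMap (TopCat.toSSet.map
        (TopCat.ofHom τ)) R - 𝟙 _) n = SSet.homologyMap (TopCat.toSSet.map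
        (TopCat.ofHom τ)) R n - 𝟙 _ := by
      rw [HomologicalComplex.homologyMap_sub, HomologicalComplex.homologyMap_id]
    exact congr(ModuleCat.Hom.hom $h)
  let ε : RatHomology 0 (X × ℝ) ⟶ R := (TopCat.toSSet.obj (TopCat.of (X × ℝ))).homology₀ε R
  have hε : IsIso ε := inferInstanceAs (IsIso ((TopCat.of (X × ℝ)).singularHomology₀ε R))
  have hτ0 : ratHomologyMap 0 τ = LinearMap.id := by
    have h : ModuleCat.ofHom (ratHomologyMap 0 τ) ≫ ε = 𝟙 _ ≫ ε :=
      (SSet.homologyMap_homology₀ε R (TopCat.toSSet.map (TopCat.ofHom τ))).trans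
        (Category.id_comp _).symm
    exact congr(ModuleCat.Hom.hom $((cancel_mono ε).1 h))
  have hH0 : Module.finrank ℚ (RatHomology 0 (X × ℝ)) = 1 := by
    rw [(asIso ε).toLinearEquiv.finrank_eq, (ULift.moduleEquiv (R := ℚ) (M := ℚ)).finrank_eq]
    exact Module.finrank_self ℚ
  have ex1 := (hS.homology_exact₂ 1).moduleCat_range_eq_ker
  have ex2 := (hS.homology_exact₃ 1 0 rfl).moduleCat_range_eq_ker
  have ex3 := (hS.homology_exact₁ 1 0 rfl).moduleCat_range_eq_ker
  let ψ := (coverHomotopyEquiv X).ratHomologyEquiv 1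
  have : Module.Finite ℚ (RatHomology 1 (X × ℝ)) := Module.Finite.equiv ψ.symm
  have hψ (c : RatHomology 1 (X × ℝ)) :
      ψ (ratHomologyMap 1 τ c) = ratHomologyMap 1 (φ : C(X, X)) (ψ c) := by
    have : (coverHomotopyEquiv X).toFun.comp τ = (φ : C(X, X)).comp (coverHomotopyEquiv X).toFun :=
      rfl
    exact (LinearMap.congr_fun (ratHomologyMap_comp 1 _ τ) c).symm.trans
      ((LinearMap.congr_fun congr(ratHomologyMap 1 $this) c).trans
        (LinearMap.congr_fun (ratHomologyMap_comp 1 _ _) c))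
  have hδ : Function.Surjective (hS.δ 1 0 rfl).hom := by
    rw [← LinearMap.range_eq_top]
    refine ex3.trans ?_
    rw [LinearMap.ker_eq_top]
    exact (hmap 0).trans (sub_eq_zero.2 hτ0)
  obtain ⟨h1, h2⟩ := LinearMap.finrank_of_exact_of_finrank_eq_one
    (ratHomologyMap 1 τ - LinearMap.id) (ratHomologyMap 1 (cover φ)) (hS.δ 1 0 rfl).hom
    (by exact (congr_arg _ (hmap 1)).symm.trans ex1) ex2 hδ hH0
  refine ⟨h1, h2.trans ?_⟩
  have hker : (LinearMap.ker (ratHomologyMap 1 τ - LinearMap.id)).map ψ.toLinearMap =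
      Module.End.eigenspace (ratHomologyMap 1 (φ : C(X, X))) (1 : ℚ) := by
    ext v
    obtain ⟨c, rfl⟩ := ψ.surjective v
    rw [Module.End.mem_eigenspace_iff, one_smul, ← hψ, ψ.injective.eq_iff]
    simp [sub_eq_zero]
  rw [← hker, LinearEquiv.finrank_map_eq]

end MappingTorus

/-! ### Affine singular simplices and classes of paths -/

section AffineSimplices

lemma stdSimplex.sum_map_smul {V : Type*} [AddCommGroup V] [Module ℝ V] {m n : ℕ}
    (f : Fin m → Fin n) (s : stdSimplex ℝ (Fin m)) (v : Fin n → V) :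
    ∑ j, (stdSimplex.map f s) j • v j = ∑ i, s i • v (f i) := by
  simp only [stdSimplex.map_coe, FunOnFinite.linearMap_apply_apply, Finset.sum_smul]
  rw [← Finset.sum_fiberwise (s := Finset.univ) (g := f)]
  refine Finset.sum_congr rfl fun j _ => Finset.sum_congr rfl fun i hi => ?_
  rw [(Finset.mem_filter.1 hi).2]

open Simplicial

variable {X : Type u} [TopologicalSpace X]
  {V : Type*} [AddCommGroup V] [Module ℝ V] [TopologicalSpace V] [IsTopologicalAddGroup V]
  [ContinuousSMul ℝ V]
  {V' : Type*} [AddCommGroup V'] [Module ℝ V'] [TopologicalSpace V'] [IsTopologicalAddGroup V']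
  [ContinuousSMul ℝ V']

/-- The singular simplex `s ↦ G (∑ i, s i • v i)`, the restriction of a map `G : V → X` to the
affine simplex with vertices `v i`. -/
noncomputable def TopCat.affineSimplex (n : ℕ) (G : C(V, X)) (v : Fin (n + 1) → V) :
    (TopCat.toSSet.obj (TopCat.of X)) _⦋n⦌ :=
  (TopCat.toSSetObjEquiv (TopCat.of X) (.op ⦋n⦌)).symm
    ⟨fun s : stdSimplex ℝ (Fin (n + 1)) => G (∑ i, s i • v i), by
      refine G.continuous.comp (continuous_finsetSum _ fun i _ => ?_)
      exact ((continuous_apply i).comp continuous_subtype_val).smul continuous_const⟩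

lemma TopCat.δ_affineSimplex (n : ℕ) (G : C(V, X)) (v : Fin (n + 2) → V) (i : Fin (n + 2)) :
    (TopCat.toSSet.obj (TopCat.of X)).δ i (TopCat.affineSimplex (n + 1) G v) =
      TopCat.affineSimplex n G (v ∘ i.succAbove) := by
  apply (TopCat.toSSetObjEquiv (TopCat.of X) (.op ⦋n⦌)).injective
  ext s
  exact congr_arg G (stdSimplex.sum_map_smul (i.succAbove) s v)

end AffineSimplices

section PathClass

open Simplicial

variable {X : Type u} [TopologicalSpace X]
  {V : Type*} [AddCommGroup V] [Module ℝ V] [TopologicalSpace V] [IsTopologicalAddGroup V]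
  [ContinuousSMul ℝ V]
  {V' : Type*} [AddCommGroup V'] [Module ℝ V'] [TopologicalSpace V'] [IsTopologicalAddGroup V']
  [ContinuousSMul ℝ V']

/-- The rational singular chain complex. -/
noncomputable abbrev RatChains (X : Type u) [TopologicalSpace X] :
    ChainComplex (ModuleCat.{u} ℚ) ℕ :=
  (TopCat.toSSet.obj (TopCat.of X)).chainComplex (ModuleCat.of ℚ (ULift.{u} ℚ))

/-- The chain given by a single simplex with coefficient `1`. -/
noncomputable def simplexChain {n : ℕ} (s : (TopCat.toSSet.obj (TopCat.of X)) _⦋n⦌) :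
    (RatChains X).X n :=
  (TopCat.toSSet.obj (TopCat.of X)).ιChainComplex (R := ModuleCat.of ℚ (ULift.{u} ℚ)) s
    (ULift.up.{u} (1 : ℚ))

lemma d_simplexChain {n : ℕ} (s : (TopCat.toSSet.obj (TopCat.of X)) _⦋n + 1⦌) :
    (RatChains X).d (n + 1) n (simplexChain s) =
      ∑ i : Fin (n + 2), (-1 : ℤ) ^ i.val •
        simplexChain ((TopCat.toSSet.obj (TopCat.of X)).δ i s) := by
  have := congr(ModuleCat.Hom.hom $(SSet.ιChainComplex_d
    (R := ModuleCat.of ℚ (ULift.{u} ℚ)) _ s) (ULift.up.{u} (1 : ℚ)))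
  refine this.trans ?_
  rw [ModuleCat.hom_sum, LinearMap.sum_apply]
  rfl

/-- The class, in `1`-chains modulo boundaries, of the image under `G` of the segment `[a, b]`. -/
noncomputable def segmentClass (G : C(V, X)) (a b : V) : (RatChains X).opcycles 1 :=
  (RatChains X).pOpcycles 1 (simplexChain (TopCat.affineSimplex 1 G ![a, b]))

lemma segmentClass_congr {G : C(V, X)} {G' : C(V', X)} {a b : V} {a' b' : V'}
    (h : ∀ t ∈ Set.Icc (0 : ℝ) 1, G ((1 - t) • a + t • b) = G' ((1 - t) • a' + t • b')) :
    segmentClass G a b = segmentClass G' a' b' := by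
  unfold segmentClass
  congr 2
  apply (TopCat.toSSetObjEquiv (TopCat.of X) (.op ⦋1⦌)).injective
  ext s
  have hs : s 0 = 1 - s 1 := by
    have := s.2.2
    rw [Fin.sum_univ_two] at this
    exact eq_sub_of_add_eq this
  have := h (s 1) (mem_Icc_of_mem_stdSimplex s.2 1)
  simp only [TopCat.affineSimplex, Equiv.apply_symm_apply, ContinuousMap.coe_mk]
  simpa [Fin.sum_univ_two, hs] using this

/-- The boundary of the triangle `a b c`. -/
lemma segmentClass_add (G : C(V, X)) (a b c : V) :
    segmentClass G a b + segmentClass G b c = segmentClass G a c := by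
  have h0 : (RatChains X).pOpcycles 1 ((RatChains X).d 2 1
      (simplexChain (TopCat.affineSimplex 2 G ![a, b, c]))) = 0 :=
    congr(ModuleCat.Hom.hom $((RatChains X).d_pOpcycles 2 1) _)
  have e0 : (![a, b, c] : Fin 3 → V) ∘ (0 : Fin 3).succAbove = ![b, c] := by
    ext i; fin_cases i <;> rfl
  have e1 : (![a, b, c] : Fin 3 → V) ∘ (1 : Fin 3).succAbove = ![a, c] := by
    ext i; fin_cases i <;> rfl
  have e2 : (![a, b, c] : Fin 3 → V) ∘ (2 : Fin 3).succAbove = ![a, b] := by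
    ext i; fin_cases i <;> rfl
  rw [d_simplexChain, map_sum, Fin.sum_univ_three] at h0
  simp only [TopCat.δ_affineSimplex, e0, e1, e2, map_zsmul] at h0
  rw [← sub_eq_zero, ← h0]
  unfold segmentClass
  simp
  abel

lemma segmentClass_self (G : C(V, X)) (a : V) : segmentClass G a a = 0 := by
  simpa using segmentClass_add G a a a

lemma segmentClass_eq_zero {G : C(V, X)} {a b : V}
    (h : ∀ t ∈ Set.Icc (0 : ℝ) 1, G ((1 - t) • a + t • b) = G a) : segmentClass G a b = 0 := by
  rw [← segmentClass_self G a]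
  refine segmentClass_congr fun t ht => ?_
  rw [h t ht, ← add_smul, sub_add_cancel, one_smul]

/-- The singular `0`-simplex at a point. -/
noncomputable def pointSimplex (x : X) : (TopCat.toSSet.obj (TopCat.of X)) _⦋0⦌ :=
  (TopCat.toSSetObjEquiv (TopCat.of X) (.op ⦋0⦌)).symm (ContinuousMap.const _ x)

lemma affineSimplex_zero (G : C(V, X)) (v : Fin 1 → V) :
    TopCat.affineSimplex 0 G v = pointSimplex (G (v 0)) := by
  apply (TopCat.toSSetObjEquiv (TopCat.of X) (.op ⦋0⦌)).injective
  ext s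
  simp [TopCat.affineSimplex, pointSimplex]

/-- The boundary of the class of a path. -/
lemma fromOpcycles_segmentClass (G : C(V, X)) (a b : V) :
    (RatChains X).fromOpcycles 1 0 (segmentClass G a b) =
      simplexChain (pointSimplex (G b)) - simplexChain (pointSimplex (G a)) := by
  have h : (RatChains X).fromOpcycles 1 0 (segmentClass G a b) =
      (RatChains X).d 1 0 (simplexChain (TopCat.affineSimplex 1 G ![a, b])) :=
    congr(ModuleCat.Hom.hom $((RatChains X).p_fromOpcycles 1 0) _)
  rw [h, d_simplexChain, Fin.sum_univ_two, TopCat.δ_affineSimplex, TopCat.δ_affineSimplex,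
    affineSimplex_zero, affineSimplex_zero]
  simp [sub_eq_add_neg]

lemma ιChainComplex_apply {n : ℕ} (s : (TopCat.toSSet.obj (TopCat.of X)) _⦋n⦌)
    (r : ULift.{u} ℚ) :
    (TopCat.toSSet.obj (TopCat.of X)).ιChainComplex (R := ModuleCat.of ℚ (ULift.{u} ℚ)) s r =
      r.down • simplexChain s := by
  unfold simplexChain
  rw [← map_smul]
  congr 1
  ext
  simp

/-- Every singular `1`-simplex is a path on `[0, 1]`, extended to `ℝ` by constants. -/
lemma exists_eq_affineSimplex (s : (TopCat.toSSet.obj (TopCat.of X)) _⦋1⦌) :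
    ∃ G : C(ℝ, X), s = TopCat.affineSimplex 1 G ![0, 1] := by
  let f : C(stdSimplex ℝ (Fin 2), X) := TopCat.toSSetObjEquiv (TopCat.of X) (.op ⦋1⦌) s
  let c (t : ℝ) : unitInterval := Set.projIcc 0 1 zero_le_one t
  have hc : Continuous c := continuous_projIcc
  let g : C(ℝ, stdSimplex ℝ (Fin 2)) :=
    ⟨fun t => ⟨![1 - c t, c t], by
      refine ⟨fun i => ?_, by simp⟩
      fin_cases i
      · simpa using (c t).2.2
      · exact (c t).2.1⟩, by
      refine Continuous.subtype_mk (continuous_pi fun i => ?_) _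
      fin_cases i
      · exact continuous_const.sub (continuous_subtype_val.comp hc)
      · exact continuous_subtype_val.comp hc⟩
  refine ⟨f.comp g, ?_⟩
  apply (TopCat.toSSetObjEquiv (TopCat.of X) (.op ⦋1⦌)).injective
  ext x
  change f x = f (g (∑ i, x i • ![(0 : ℝ), 1] i))
  congr 1
  have h1 : x 0 + x 1 = 1 := by
    rw [← Fin.sum_univ_two]
    exact x.2.2
  have h2 : (c (x 1) : ℝ) = x 1 :=
    congr_arg Subtype.val (Set.projIcc_of_mem zero_le_one (mem_Icc_of_mem_stdSimplex x.2 1))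
  have h3 : ∑ i, x i • ![(0 : ℝ), 1] i = x 1 := by
    rw [Fin.sum_univ_two]
    simp
  rw [h3]
  refine Subtype.ext (funext fun i => ?_)
  change x i = ![1 - (c (x 1) : ℝ), c (x 1)] i
  rw [h2]
  fin_cases i
  · exact eq_sub_of_add_eq h1
  · rfl

/-- The classes of paths span the `1`-chains modulo boundaries. -/
lemma span_segmentClass :
    Submodule.span ℚ (Set.range fun G : C(ℝ, X) => segmentClass G 0 1) = ⊤ := by
  refine eq_top_iff.2 fun c _ => ?_
  have hp : Function.Surjective ((RatChains X).pOpcycles 1) :=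
    (ModuleCat.epi_iff_surjective _).1 inferInstance
  obtain ⟨c, rfl⟩ := hp c
  obtain ⟨c, rfl⟩ := ((TopCat.toSSet.obj (TopCat.of X)).finsuppEquivChain _ 1).surjective c
  induction c using Finsupp.induction_linear with
  | zero => simp
  | add a b ha hb =>
    rw [map_add, map_add]
    exact Submodule.add_mem _ (ha trivial) (hb trivial)
  | single s r =>
    obtain ⟨G, rfl⟩ := exists_eq_affineSimplex s
    rw [SSet.finsuppEquivChain_single, ιChainComplex_apply, map_smul]
    exact Submodule.smul_mem _ _ (Submodule.subset_span ⟨G, rfl⟩)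

/-- A linear map on `0`-chains with prescribed values on points. -/
lemma exists_linearMap_pointSimplex {A : Type*} [AddCommGroup A] [Module ℚ A] (q : X → A) :
    ∃ h : (RatChains X).X 0 →ₗ[ℚ] A, ∀ x, h (simplexChain (pointSimplex x)) = q x := by
  let v (s : (TopCat.toSSet.obj (TopCat.of X)) _⦋0⦌) : X :=
    TopCat.toSSetObjEquiv (TopCat.of X) (.op ⦋0⦌) s ⟨_, single_mem_stdSimplex ℝ 0⟩
  let e := (TopCat.toSSet.obj (TopCat.of X)).finsuppEquivChain
    (ModuleCat.of ℚ (ULift.{u} ℚ)) 0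
  refine ⟨Finsupp.lsum ℚ (fun s => (LinearMap.toSpanSingleton ℚ A (q (v s))).comp
    (ULift.moduleEquiv (R := ℚ) (M := ℚ)).toLinearMap) ∘ₗ e.symm.toLinearMap, fun x => ?_⟩
  have he : e.symm (simplexChain (pointSimplex x)) =
      Finsupp.single (pointSimplex x) (ULift.up.{u} (1 : ℚ)) := by
    rw [LinearEquiv.symm_apply_eq]
    exact (SSet.finsuppEquivChain_single _ _).symm
  have hv : v (pointSimplex x) = x := by
    simp [v, pointSimplex]
  rw [LinearMap.comp_apply, LinearEquiv.coe_coe, he, Finsupp.lsum_single]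
  simp [hv]

end PathClass

/-! ### Finiteness of the first homology -/

section Potential

variable {X : Type u} [TopologicalSpace X]

/-- A potential on `U`: a function `Q` whose increments are the classes, modulo boundaries in `X`,
of the paths in `U`. Its existence says that these classes depend only on the end points. -/
def IsPotential (U : Set X) (Q : X → (RatChains X).opcycles 1) : Prop :=
  ∀ G : C(ℝ, X), (∀ t ∈ Set.Icc (0 : ℝ) 1, G t ∈ U) → segmentClass G 0 1 = Q (G 1) - Q (G 0)

lemma IsPotential.mono {U U' : Set X} {Q : X → (RatChains X).opcycles 1} (h : IsPotential U Q)
    (hU : U' ⊆ U) : IsPotential U' Q :=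
  fun G hG => h G fun t ht => hU (hG t ht)

lemma IsPotential.segmentClass_eq {U : Set X} {Q : X → (RatChains X).opcycles 1}
    (h : IsPotential U Q) (G : C(ℝ, X)) {a b : ℝ} (hab : a ≤ b)
    (hG : ∀ t ∈ Set.Icc a b, G t ∈ U) : segmentClass G a b = Q (G b) - Q (G a) := by
  let G' : C(ℝ, X) := G.comp ⟨fun t => (1 - t) • a + t • b, by fun_prop⟩
  have h1 : segmentClass G a b = segmentClass G' 0 1 :=
    segmentClass_congr fun t _ => by simp [G']
  rw [h1, h G' fun t ht => hG _ (convex_Icc a b (Set.left_mem_Icc.2 hab)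
    (Set.right_mem_Icc.2 hab) (sub_nonneg.2 ht.2) ht.1 (sub_add_cancel _ _))]
  simp [G']

/-- A subset which is contractible in `X` carries a potential: by the homotopy, a path from `x`
to `y` is homologous to the track of `x` followed by the reversed track of `y`. -/
lemma exists_isPotential_of_nullhomotopic {U : Set X}
    (hU : (⟨Subtype.val, continuous_subtype_val⟩ : C(U, X)).Nullhomotopic) :
    ∃ Q, IsPotential U Q := by
  classical
  obtain ⟨x₀, ⟨F⟩⟩ := hU
  let c (t : ℝ) : unitInterval := Set.projIcc 0 1 zero_le_one t
  have hc : Continuous c := continuous_projIcc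
  have hcI (t : ℝ) : (c t : ℝ) ∈ Set.Icc (0 : ℝ) 1 := (c t).2
  have hc0 : c 0 = 0 := Set.projIcc_left _
  have hc1 : c 1 = 1 := Set.projIcc_right _
  let track (x : U) : C(ℝ, X) := ⟨fun r => F (c r, x), by fun_prop⟩
  refine ⟨fun x => if h : x ∈ U then -segmentClass (track ⟨x, h⟩) 0 1 else 0, fun G hG => ?_⟩
  let g : C(ℝ, U) := ⟨fun t => ⟨G (c t), hG _ (hcI t)⟩, by fun_prop⟩
  let H : C(ℝ × ℝ, X) := ⟨fun z => F (c z.2, g z.1), by fun_prop⟩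
  have hg0 : g 0 = ⟨G 0, hG 0 (by simp)⟩ := by
    ext; simp [g, hc0]
  have hg1 : g 1 = ⟨G 1, hG 1 (by simp)⟩ := by
    ext; simp [g, hc1]
  -- the four sides of the square
  have hbot : segmentClass H (0, 0) (1, 0) = segmentClass G 0 1 :=
    segmentClass_congr fun t ht => by
      have : c t = ⟨t, ht⟩ := Set.projIcc_of_mem zero_le_one ht
      simp [H, g, hc0, this]
  have htop : segmentClass H (0, 1) (1, 1) = 0 :=
    segmentClass_eq_zero fun t _ => by simp [H, hc1]
  have hleft : segmentClass H (0, 0) (0, 1) = segmentClass (track (g 0)) 0 1 :=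
    segmentClass_congr fun t _ => by simp [H, track]
  have hright : segmentClass H (1, 0) (1, 1) = segmentClass (track (g 1)) 0 1 :=
    segmentClass_congr fun t _ => by simp [H, track]
  have h1 := segmentClass_add H (0, 0) (1, 0) (1, 1)
  have h2 := segmentClass_add H (0, 0) (0, 1) (1, 1)
  rw [hbot, hright] at h1
  rw [hleft, htop, add_zero] at h2
  beta_reduce
  rw [dif_pos (hG 1 (by simp)), dif_pos (hG 0 (by simp)), ← hg0, ← hg1, h2, ← h1]
  abel

/-- Two potentials differ by a constant on the overlap of path connected sets, as soon as the
union of these sets carries a potential. -/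
lemma IsPotential.sub_eq_sub {U U' : Set X} {Q Q' Q'' : X → (RatChains X).opcycles 1}
    (h : IsPotential U Q) (h' : IsPotential U' Q') (h'' : IsPotential (U ∪ U') Q'')
    (hU : IsPathConnected U) (hU' : IsPathConnected U') {x z : X} (hx : x ∈ U ∩ U')
    (hz : z ∈ U ∩ U') : Q x - Q' x = Q z - Q' z := by
  have key {U : Set X} {Q Q'' : X → (RatChains X).opcycles 1} (h : IsPotential U Q)
      (h'' : IsPotential U Q'') (hU : IsPathConnected U) (hx : x ∈ U) (hz : z ∈ U) :
      Q x - Q z = Q'' x - Q'' z := by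
    obtain ⟨γ, hγ⟩ := hU.joinedIn z hz x hx
    let G : C(ℝ, X) := ⟨γ.extend, γ.continuous_extend⟩
    have hG : ∀ t ∈ Set.Icc (0 : ℝ) 1, G t ∈ U := fun t ht => by
      simpa [G, γ.extend_apply ht] using hγ ⟨t, ht⟩
    have := (h G hG).symm.trans (h'' G hG)
    simpa [G] using this
  have h1 := key h (h''.mono Set.subset_union_left) hU hx.1 hz.1
  have h2 := key h' (h''.mono Set.subset_union_right) hU' hx.2 hz.2
  rw [← sub_eq_zero, sub_sub_sub_comm, h1, h2, sub_self]

end Potential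

section Finiteness

variable {X : Type u} [TopologicalSpace X]

/-- Finite generation of `H₁` from a finite cover by path connected open sets such that the union
of any two that meet carries a potential. -/
lemma finite_ratHomology_one_of_isPotential {ι : Type*} [Finite ι] (V : ι → Set X)
    (hopen : ∀ i, IsOpen (V i)) (hcover : ∀ x, ∃ i, x ∈ V i)
    (hconn : ∀ i, IsPathConnected (V i))
    (hpot : ∀ i j, (V i ∩ V j).Nonempty → ∃ Q, IsPotential (V i ∪ V j) Q) :
    Module.Finite ℚ (RatHomology 1 X) := by
  classical
  have hpot' (i : ι) : ∃ Q, IsPotential (V i) Q := by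
    obtain ⟨Q, hQ⟩ := hpot i i (by simpa using (hconn i).nonempty)
    exact ⟨Q, hQ.mono Set.subset_union_left⟩
  choose Q hQ using hpot'
  choose idx hidx using hcover
  -- the constants `Q i - Q j` on the overlaps
  let w (p : ι × ι) : (RatChains X).opcycles 1 :=
    if h : (V p.1 ∩ V p.2).Nonempty then Q p.1 h.some - Q p.2 h.some else 0
  have hw (i j : ι) (x : X) (hi : x ∈ V i) (hj : x ∈ V j) : Q i x - Q j x = w (i, j) := by
    have h : (V i ∩ V j).Nonempty := ⟨x, hi, hj⟩
    obtain ⟨Q'', hQ''⟩ := hpot i j h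
    simp only [w]
    rw [dif_pos h]
    exact (hQ i).sub_eq_sub (hQ j) hQ'' (hconn i) (hconn j) ⟨hi, hj⟩ h.some_mem
  let W : Submodule ℚ ((RatChains X).opcycles 1) := Submodule.span ℚ (Set.range w)
  have hW : Module.Finite ℚ W := Module.Finite.span_of_finite ℚ (Set.finite_range w)
  obtain ⟨h, hh⟩ := exists_linearMap_pointSimplex (fun x => Q (idx x) x)
  -- `T` fixes cycles and maps every chain into `W`
  let T : (RatChains X).opcycles 1 →ₗ[ℚ] (RatChains X).opcycles 1 :=
    LinearMap.id - h ∘ₗ ((RatChains X).fromOpcycles 1 0).hom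
  have hTseg (G : C(ℝ, X)) (a b : ℝ) : T (segmentClass G a b) =
      segmentClass G a b - (Q (idx (G b)) (G b) - Q (idx (G a)) (G a)) := by
    have h1 := congr(h $(fromOpcycles_segmentClass G a b))
    rw [map_sub, hh, hh] at h1
    rw [← h1]
    rfl
  have hTsmall (G : C(ℝ, X)) (a b : ℝ) (hab : a ≤ b) (k : ι)
      (hG : ∀ t ∈ Set.Icc a b, G t ∈ V k) : T (segmentClass G a b) ∈ W := by
    rw [hTseg, (hQ k).segmentClass_eq G hab hG, sub_sub_sub_comm,
      hw k _ _ (hG b (Set.right_mem_Icc.2 hab)) (hidx _),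
      hw k _ _ (hG a (Set.left_mem_Icc.2 hab)) (hidx _)]
    exact Submodule.sub_mem _ (Submodule.subset_span ⟨_, rfl⟩) (Submodule.subset_span ⟨_, rfl⟩)
  have hTpath (G : C(ℝ, X)) : T (segmentClass G 0 1) ∈ W := by
    let c (i : ι) : Set unitInterval := (fun s : unitInterval => G s) ⁻¹' V i
    have hc (i : ι) : IsOpen (c i) := (hopen i).preimage (by fun_prop)
    obtain ⟨t, ht0, htm, ⟨N, hN⟩, ht⟩ := exists_monotone_Icc_subset_open_cover_unitInterval hc
      fun s _ => Set.mem_iUnion.2 ⟨idx (G s), hidx _⟩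
    have hn (n : ℕ) : T (segmentClass G 0 (t n)) ∈ W := by
      induction n with
      | zero =>
        rw [ht0, Set.Icc.coe_zero, segmentClass_self, map_zero]
        exact W.zero_mem
      | succ n ih =>
        rw [← segmentClass_add G 0 (t n : ℝ), map_add]
        obtain ⟨k, hk⟩ := ht n
        refine Submodule.add_mem _ ih (hTsmall G _ _ (htm n.le_succ) k fun s hs => ?_)
        exact @hk ⟨s, (t n).2.1.trans hs.1, hs.2.trans (t (n + 1)).2.2⟩ hs
    simpa [hN N le_rfl] using hn N
  have hT (c : (RatChains X).opcycles 1) : T c ∈ W := by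
    have hc : c ∈ Submodule.span ℚ (Set.range fun G : C(ℝ, X) => segmentClass G 0 1) := by
      rw [span_segmentClass]
      trivial
    induction hc using Submodule.span_induction with
    | mem c hc => obtain ⟨G, rfl⟩ := hc; exact hTpath G
    | zero => simp
    | add a b _ _ ha hb => rw [map_add]; exact W.add_mem ha hb
    | smul r a _ ha => rw [map_smul]; exact W.smul_mem r ha
  let j : RatHomology 1 X →ₗ[ℚ] (RatChains X).opcycles 1 := ((RatChains X).homologyι 1).hom
  have hj : Function.Injective j := (ModuleCat.mono_iff_injective ((RatChains X).homologyι 1)).1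
    inferInstance
  have hTj (c : RatHomology 1 X) : T (j c) = j c := by
    have : ((RatChains X).fromOpcycles 1 0).hom (j c) = 0 :=
      congr(ModuleCat.Hom.hom $((RatChains X).homologyι_comp_fromOpcycles 1 0) c)
    simp [T, this]
  exact Module.Finite.of_injective (j.codRestrict W fun c => hTj c ▸ hT (j c))
    fun a b hab => hj (congr_arg Subtype.val hab)

open Uniformity in
/-- The first homology of a compact Hausdorff space which is locally path connected and
semilocally contractible is finite-dimensional. -/
theorem finite_ratHomology_one [CompactSpace X] [T2Space X] [LocallyPathConnectedSpace X]
    (hX : ∀ x : X, ∃ U ∈ nhds x,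
      (⟨Subtype.val, continuous_subtype_val⟩ : C(U, X)).Nullhomotopic) :
    Module.Finite ℚ (RatHomology 1 X) := by
  let _ : UniformSpace X := uniformSpaceOfCompactR1
  choose U hU hnull using hX
  obtain ⟨D, hD, hDU⟩ := lebesgue_number_lemma_nhds (isCompact_univ (X := X)) (U := U)
    fun x _ => hU x
  obtain ⟨D', hD', hsymm, hcomp⟩ := comp_symm_of_uniformity hD
  have hV (x : X) : ∃ V : Set X, (IsOpen V ∧ x ∈ V ∧ IsPathConnected V) ∧
      V ⊆ UniformSpace.ball x D' :=
    (isOpen_isPathConnected_basis x).mem_iff.1 (UniformSpace.ball_mem_nhds x hD')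
  choose V hV hVD using hV
  obtain ⟨s, hs⟩ := isCompact_univ.elim_nhds_subcover V
    fun x _ => (hV x).1.mem_nhds (hV x).2.1
  refine finite_ratHomology_one_of_isPotential (fun i : s => V i) (fun i => (hV i).1)
    (fun x => by simpa using hs.2 (Set.mem_univ x)) (fun i => (hV i).2.2) ?_
  rintro i j ⟨z, hzi, hzj⟩
  obtain ⟨y, hy⟩ := hDU z trivial
  obtain ⟨Q, hQ⟩ := exists_isPotential_of_nullhomotopic (hnull y)
  refine ⟨Q, hQ.mono (subset_trans ?_ hy)⟩
  have key (i : X) (hz : z ∈ V i) : V i ⊆ UniformSpace.ball z D := fun v hv =>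
    hcomp ⟨i, hsymm (hVD i hz), hVD i hv⟩
  exact Set.union_subset (key i hzi) (key j hzj)

end Finiteness

/-- Charts make a space modelled on a normed space semilocally contractible. -/
lemma ChartedSpace.exists_nhds_nullhomotopic {X E : Type*} [TopologicalSpace X]
    [NormedAddCommGroup E] [NormedSpace ℝ E] [ChartedSpace E X] (x : X) :
    ∃ U ∈ nhds x, (⟨Subtype.val, continuous_subtype_val⟩ : C(U, X)).Nullhomotopic := by
  let e := chartAt E x
  obtain ⟨r, hr, hB⟩ := Metric.isOpen_iff.1 e.open_target (e x)
    (e.map_source (mem_chart_source E x))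
  let U : Set X := e.source ∩ e ⁻¹' Metric.ball (e x) r
  have : ContractibleSpace (Metric.ball (e x) r) :=
    (convex_ball _ _).contractibleSpace ⟨e x, Metric.mem_ball_self hr⟩
  refine ⟨U, (e.isOpen_inter_preimage Metric.isOpen_ball).mem_nhds
    ⟨mem_chart_source E x, Metric.mem_ball_self hr⟩, ?_⟩
  let q : C(U, Metric.ball (e x) r) :=
    ⟨fun y => ⟨e y, y.2.2⟩, by
      refine Continuous.subtype_mk ?_ _
      exact (e.continuousOn.mono Set.inter_subset_left).domRestrict⟩
  let σ : C(Metric.ball (e x) r, X) :=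
    ⟨fun v => e.symm v, (e.symm.continuousOn.mono hB).domRestrict⟩
  have hσq : (⟨Subtype.val, continuous_subtype_val⟩ : C(U, X)) =
      σ.comp ((ContinuousMap.id _).comp q) := by
    ext y
    exact (e.left_inv y.2.1).symm
  rw [hσq]
  exact ((id_nullhomotopic _).comp_left q).comp_right σ

/-! ### The first Betti number of a mapping torus -/

theorem mainTheorem8 (S : Type u) [TopologicalSpace S] [T2Space S] [CompactSpace S]
    [ConnectedSpace S] [ChartedSpace (EuclideanSpace ℝ (Fin 2)) S] [IsManifold (𝓡 2) ∞ S]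
    (_o : SurfaceOrientation S) (φ : Diffeomorph (𝓡 2) (𝓡 2) S S ∞) :
    Module.Finite ℚ (RatHomology 1 S) ∧
    Module.Finite ℚ (RatHomology 1 (MappingTorus φ.toHomeomorph)) ∧
    bettiNumber 1 (MappingTorus φ.toHomeomorph) =
      Module.finrank ℚ
        (Module.End.eigenspace (ratHomologyMap 1 (φ.toHomeomorph : C(S, S))) (1 : ℚ)) + 1 ∧
    (bettiNumber 1 (MappingTorus φ.toHomeomorph) = 1 ↔
      ¬ Module.End.HasEigenvalue (ratHomologyMap 1 (φ.toHomeomorph : C(S, S))) (1 : ℚ)) := by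
  have : LocallyPathConnectedSpace S :=
    ChartedSpace.locallyPathConnectedSpace (EuclideanSpace ℝ (Fin 2)) S
  have : PathConnectedSpace S := .of_locallyPathConnectedSpace
  have hS : Module.Finite ℚ (RatHomology 1 S) :=
    finite_ratHomology_one
      (ChartedSpace.exists_nhds_nullhomotopic (E := EuclideanSpace ℝ (Fin 2)))
  obtain ⟨hM, hb⟩ := MappingTorus.finrank_ratHomology_one φ.toHomeomorph
  refine ⟨hS, hM, hb, ?_⟩
  rw [bettiNumber, hb, Nat.add_eq_right, Submodule.finrank_eq_zero]
  exact not_not.symm
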